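/- Let $q$ be a power of a prime, let $\epsilon\in\{1,-1\}$ and let $n\geq 3$ be an integer, and assume that $3\mid (q-\epsilon)$. Let $S=\mathrm{PSL}_n^\epsilon(q)$ denote the quotient of $\mathrm{SL}_n^\epsilon(q)$ by its centre, where $\mathrm{SL}_n^{1}(q)=\mathrm{SL}_n(q)$ is the special linear group over the field $\mathbb{F}_q$ and $\mathrm{SL}_n^{-1}(q)=\mathrm{SU}_n(q)$ is the special unitary group, consisting of the matrices $A\in\mathrm{SL}_n(\mathbb{F}_{q^2})$ such that $\overline{A}^{\,\mathrm{T}}A=I_n$, where $\overline{A}$ arises from $A$ by raising every entry to its $q$-th power. Let $Q$ be a Sylow $3$-subgroup of $S$ and let $Q'=[Q,Q]$ be its derived subgroup. Then $[Q:Q']=9$ if and only if $n=3$, or $n=4$ and $(q-\epsilon)_3=3$, where $(q-\epsilon)_3$ denotes the largest power of $3$ dividing $q-\epsilon$. -/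

import Mathlib

/-- The sign `ε ∈ {1, -1}` that separates linear groups (`ε = 1`) from unitary groups
(`ε = -1`). -/
inductive Eps : Type
  | plus : Eps
  | minus : Eps

/-- The value of the sign as an integer. -/
def Eps.val : Eps → ℤ
  | Eps.plus => 1
  | Eps.minus => -1

/-- The field of order `q ^ 2`, where `q = p ^ f`, carries the involution `x ↦ x ^ q`. -/
noncomputable instance frobeniusStarRing (p f : ℕ) [Fact p.Prime] :
    StarRing (GaloisField p (2 * f)) where
  star x := x ^ p ^ f
  star_involutive x := by
    rcases Nat.eq_zero_or_pos f with rfl | hf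
    · simp
    · change (x ^ p ^ f) ^ p ^ f = x
      have h : Nat.card (GaloisField p (2 * f)) = p ^ f * p ^ f := by
        rw [GaloisField.card p (2 * f) (by omega), two_mul, pow_add]
      have : Fintype (GaloisField p (2 * f)) := Fintype.ofFinite _
      rw [← pow_mul, ← h, Nat.card_eq_fintype_card, FiniteField.pow_card]
  star_mul x y := by
    change (x * y) ^ p ^ f = y ^ p ^ f * x ^ p ^ f
    rw [mul_pow]; exact mul_comm _ _
  star_add x y := add_pow_char_pow x y p f

/-- `SU_n(q)` for `q = p ^ f`: the matrices `A` over the field of order `q ^ 2` with `det A = 1`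
whose inverse is the transpose of the matrix obtained by raising the entries to the power `q`. -/
abbrev SUGroup (n p f : ℕ) [Fact p.Prime] : Type :=
  Matrix.specialUnitaryGroup (Fin n) (GaloisField p (2 * f))

/-- `SL_n^ε(q)` for `q = p ^ f`: it is `SL_n(q)` for `ε = 1` and `SU_n(q)` for `ε = -1`. -/
def SLEps (ε : Eps) (n p f : ℕ) [Fact p.Prime] : Type :=
  match ε with
  | Eps.plus => Matrix.SpecialLinearGroup (Fin n) (GaloisField p f)
  | Eps.minus => SUGroup n p f

noncomputable instance SLEps.instGroup (ε : Eps) (n p f : ℕ) [Fact p.Prime] :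
    Group (SLEps ε n p f) :=
  match ε with
  | Eps.plus =>
    inferInstanceAs (Group (Matrix.SpecialLinearGroup (Fin n) (GaloisField p f)))
  | Eps.minus => inferInstanceAs (Group (SUGroup n p f))

/-- `PSL_n^ε(q)` for `q = p ^ f`: the quotient of `SL_n^ε(q)` by its centre. -/
abbrev PSLEps (ε : Eps) (n p f : ℕ) [Fact p.Prime] : Type :=
  SLEps ε n p f ⧸ Subgroup.center (SLEps ε n p f)

/-!
Write `F` for the field of definition of the matrices, so `F` has order `q` or `q ^ 2`, let `a` be
the exponent of `3` in `|F| - 1`, and let `C` be the group of elements of `Fˣ` of order dividing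
`3 ^ a`. Since `3 ∣ q - ε`, `a` is also the exponent of `3` in `q - ε`: in the unitary case `3` does
not divide `q - 1`.

*Sylow subgroups.* By the order formula for `GL_n(F)` and lifting the exponent, the exponent of `3`
in `|SL_n(F)|` is `a * (n - 1)` plus that in `n!`. This is the order of the group `K = T ⋊ P` of
monomial matrices with entries in `C` and determinant `1`, where `T` consists of the diagonal ones
and `P` is a Sylow 3-subgroup of the symmetric group. Elements `c` of `C` satisfy `c ^ (q + 1) = 1`
in the unitary case, so `K` lies in `SU_n(q) ≤ SL_n(q ^ 2)` as well, and both cases are treated at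
once, without the order of `SU_n(q)`. Hence `Q` is the image of `K` modulo the centre of
`SL_n^ε(q)`, and `[Q : Q'] = [K : K' Z]` with `Z` a group of scalar matrices
(`MonomialGroup.index_commutator_sylow`).

*Lower bounds.* As `K` is nilpotent and `T` is a normal abelian subgroup with complement `P` and
not contained in `Z`, it is not contained in `K' Z` (`Group.not_le_commutator_sup`); therefore
`[K : K' Z] > [P : P']`. For `n ≥ 6` the group `P` is not cyclic because it contains two commuting
disjoint 3-cycles (up to conjugation), so `[P : P'] ≥ 9` and the index exceeds `9`. For `n = 3` the
index is a power of `3` exceeding `3`. For `n = 4` and `n = 5` the subgroup `Z` is trivial, and the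
entries at the `n - 3` points fixed by `P` together with the projection to `P` give the lower bound
`3 * (3 ^ a) ^ (n - 3)` (`MonomialGroup.pow_mul_le_index_commutator`).

*Upper bounds.* For `σ ∈ P` the map `t ↦ ⁅σ, t⁆` is an endomorphism of `T` with values in `K'`, so
`[K : K']` is at most `|P|` times the number of its fixed points
(`MonomialGroup.index_commutator_le`).
With `σ` a 3-cycle this is at most `9` for `n = 3` and `3 * 3 ^ a` for `n = 4`.
-/

/-! ### Derived subgroups of `p`-groups -/

open scoped commutatorElement in
open Subgroup hiding commutator commutator_def in
/-- In a nilpotent group, `[A, K] Z` contains `A` only if `Z` does: otherwise `A` would lie in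
`Z` times every term of the lower central series. -/
theorem Group.le_of_le_commutator_top_sup {K : Type*} [Group K] [Group.IsNilpotent K]
    {A Z : Subgroup K} [Z.Normal] (h : A ≤ ⁅A, (⊤ : Subgroup K)⁆ ⊔ Z) : A ≤ Z := by
  obtain ⟨c, hc⟩ := Subgroup.nilpotent_iff_lowerCentralSeries.1 ‹Group.IsNilpotent K›
  have key : ∀ i, A ≤ (⊤ : Subgroup K).lowerCentralSeries i ⊔ Z := by
    intro i
    induction i with
    | zero => simp
    | succ i ih =>
      refine h.trans (sup_le ?_ le_sup_right)
      have hn : ((⊤ : Subgroup K).lowerCentralSeries (i + 1) ⊔ Z).Normal := inferInstance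
      refine commutator_le.2 fun g hg x _ => ?_
      obtain ⟨u, hu, z, hz, rfl⟩ := mem_sup_of_normal_right.1 (ih hg)
      have e : ⁅u * z, x⁆ = u * ⁅z, x⁆ * u⁻¹ * ⁅u, x⁆ := by
        simp only [commutatorElement_def]; group
      rw [e]
      refine mul_mem (hn.conj_mem _ (mem_sup_right ?_) u) (mem_sup_left ?_)
      · exact commutator_le_left Z ⊤ (commutator_mem_commutator hz (mem_top x))
      · exact commutator_mem_commutator hu (mem_top x)
  have := key c
  rwa [hc, bot_sup_eq] at this

open scoped commutatorElement in
open Subgroup hiding commutator commutator_def in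
/-- A normal abelian subgroup `A` with a complement `P` meets `K'` in `[A, K]`, as `K'` lies in
`[A, K] P`. In a nilpotent group this intersection is too small to contain `A`, also modulo `Z`. -/
theorem Group.not_le_commutator_sup {K : Type*} [Group K] [Group.IsNilpotent K]
    {A P Z : Subgroup K} [A.Normal] [Z.Normal] (hcomm : IsMulCommutative A)
    (hsup : A ⊔ P = ⊤) (hinf : A ⊓ P = ⊥) (hZA : Z ≤ A) (hAZ : ¬ A ≤ Z) :
    ¬ A ≤ commutator K ⊔ Z := by
  let B : Subgroup K := ⁅A, (⊤ : Subgroup K)⁆ ⊔ Z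
  have hBA : B ≤ A := sup_le (commutator_le_left A ⊤) hZA
  have hAB : ¬ A ≤ B := fun h => hAZ (Group.le_of_le_commutator_top_sup h)
  have hBP : (B ⊔ P).Normal := by
    refine ⟨fun x hx g => ?_⟩
    obtain ⟨a, ha, r, hr, rfl⟩ := mem_sup_of_normal_left.1 (show g ∈ A ⊔ P from hsup ▸ mem_top g)
    obtain ⟨b, hb, s, hs, rfl⟩ := mem_sup_of_normal_left.1 hx
    have e : a * r * (b * s) * (a * r)⁻¹ =
        ((a * r) * b * (a * r)⁻¹) * ⁅a, r * s * r⁻¹⁆ * (r * s * r⁻¹) := by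
      simp only [commutatorElement_def]; group
    rw [e]
    refine mul_mem (mul_mem ?_ ?_) (mem_sup_right (mul_mem (mul_mem hr hs) (inv_mem hr)))
    · exact mem_sup_left ((inferInstance : B.Normal).conj_mem b hb _)
    · exact mem_sup_left (mem_sup_left (commutator_mem_commutator ha (mem_top _)))
  have hle : commutator K ≤ B ⊔ P :=
    hBP.commutator_le_of_self_sup_commutative_eq_top
      (by rw [sup_comm, ← top_le_iff, ← hsup]; exact sup_le_sup_left le_sup_right A) hcomm
  -- Modular law: `A ⊓ (B ⊔ P) = B ⊔ (A ⊓ P) = B`.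
  intro h
  apply hAB
  have h2 : A ≤ A ⊓ (P ⊔ B) := le_inf le_rfl <|
    h.trans (sup_le (hle.trans (sup_comm B P).le) (le_sup_right.trans le_sup_right))
  intro x hx
  obtain ⟨s, hs, b, hb, rfl⟩ := mem_sup_of_normal_right.1 (h2 hx).2
  have : s ∈ A ⊓ P := ⟨by simpa using mul_mem hx (inv_mem (hBA hb)), hs⟩
  rw [hinf, mem_bot] at this
  simpa [this] using hb

open scoped commutatorElement in
open Subgroup hiding commutator commutator_def in
theorem Group.isCyclic_of_isCyclic_abelianization {K : Type*} [Group K] [Group.IsNilpotent K]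
    [IsCyclic (Abelianization K)] : IsCyclic K := by
  -- Modulo `N = [K', K]` the kernel of the map to the cyclic group `K / K'` is central, so `K / N`
  -- is commutative; thus `K' ≤ [K', K]`, which forces `K' = 1`.
  let N : Subgroup K := ⁅commutator K, (⊤ : Subgroup K)⁆
  have hNle : N ≤ (Abelianization.of : K →* _).ker := by
    rw [Abelianization.ker_of]; exact commutator_le_left _ _
  let f : K ⧸ N →* Abelianization K := QuotientGroup.lift N Abelianization.of hNle
  have hf : f.ker ≤ center (K ⧸ N) := by
    intro x hx
    induction x using QuotientGroup.induction_on with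
    | H x =>
    have hx' : x ∈ commutator K := by
      rw [← Abelianization.ker_of]; exact hx
    rw [mem_center_iff]
    intro y
    induction y using QuotientGroup.induction_on with
    | H y =>
    rw [← QuotientGroup.mk_mul, ← QuotientGroup.mk_mul, QuotientGroup.eq]
    have h : ⁅x⁻¹, y⁻¹⁆ ∈ N :=
      Subgroup.commutator_mem_commutator (inv_mem hx') (mem_top _)
    simpa [commutatorElement_def, mul_assoc] using h
  have hcom := (f.isMulCommutative_of_isCyclic_of_ker_le_center hf).is_comm.comm
  have hle : commutator K ≤ N := by
    rw [_root_.commutator_def, commutator_le]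
    intro x _ y _
    rw [← QuotientGroup.eq_one_iff]
    have := hcom (x : K ⧸ N) (y : K ⧸ N)
    rw [commutatorElement_def, QuotientGroup.mk_mul, QuotientGroup.mk_mul, QuotientGroup.mk_mul,
      this, QuotientGroup.mk_inv, QuotientGroup.mk_inv]
    group
  have hbot : commutator K = ⊥ :=
    le_bot_iff.1 (Group.le_of_le_commutator_top_sup (Z := ⊥) (by simpa using hle))
  refine isCyclic_of_injective (Abelianization.of : K →* _) ?_
  rw [← MonoidHom.ker_eq_bot_iff, Abelianization.ker_of, hbot]

/-- The index of the derived subgroup of a noncyclic finite `p`-group is at least `p ^ 2`. -/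
theorem IsPGroup.sq_le_index_commutator {p : ℕ} [hp : Fact p.Prime] {K : Type*} [Group K] [Finite K]
    (hK : IsPGroup p K) (hc : ¬ IsCyclic K) : p ^ 2 ≤ (commutator K).index := by
  have := hK.isNilpotent
  obtain ⟨k, hk⟩ := hK.index (commutator K)
  rw [hk]
  apply Nat.pow_le_pow_right hp.out.pos
  by_contra! h
  have hcard : Nat.card (Abelianization K) = p ^ k := hk
  have : IsCyclic (Abelianization K) := by
    interval_cases k
    · have := (Nat.card_eq_one_iff_unique.1 (by simpa using hcard)).1
      exact isCyclic_of_subsingleton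
    · exact isCyclic_of_prime_card (p := p) (by simpa using hcard)
  exact hc Group.isCyclic_of_isCyclic_abelianization

/-- A commutative quotient of `K` in which `Z` dies bounds the index of `K' Z` from below. -/
theorem Group.card_le_index_commutator_sup {K C : Type*} [Group K] [Finite K] [CommGroup C]
    (θ : K →* C) (hθ : Function.Surjective θ) {Z : Subgroup K} (hZ : Z ≤ θ.ker) :
    Nat.card C ≤ (commutator K ⊔ Z).index := by
  have h : commutator K ⊔ Z ≤ θ.ker := sup_le (Abelianization.commutator_subset_ker θ) hZ
  have := Nat.le_of_dvd (Nat.pos_of_ne_zero Subgroup.FiniteIndex.index_ne_zero)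
    (Subgroup.index_dvd_of_le h)
  rwa [Subgroup.index_ker, MonoidHom.range_eq_top.2 hθ, Subgroup.card_top] at this

/-- If `f` embeds `K` as a Sylow `p`-subgroup of `G`, then a Sylow `p`-subgroup of `G ⧸ N` is
isomorphic to the quotient of `K` by the preimage of `N`; this computes the index of its derived
subgroup inside `K`. -/
theorem Sylow.index_commutator_quotient {p : ℕ} [Fact p.Prime] {G K : Type*} [Group G] [Finite G]
    [Group K] (N : Subgroup G) [N.Normal] (f : K →* G) (hf : Function.Injective f)
    (hcard : Nat.card K = p ^ (Nat.card G).factorization p) (Q : Sylow p (G ⧸ N)) :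
    (commutator Q).index = (commutator K ⊔ N.comap f).index := by
  let R : Sylow p G := Sylow.ofCard f.range (by
    rw [← hcard]; exact (Nat.card_congr (MonoidHom.ofInjective hf).toEquiv).symm)
  let S : Sylow p (G ⧸ N) := R.mapSurjective (QuotientGroup.mk'_surjective N)
  let g : K →* G ⧸ N := (QuotientGroup.mk' N).comp f
  have hS : (S : Subgroup (G ⧸ N)) = g.range := by
    rw [MonoidHom.range_comp]; rfl
  let e : Q ≃* g.range := (Sylow.equiv Q S).trans (MulEquiv.subgroupCongr hS)
  have h1 : (commutator Q).index = (commutator g.range).index :=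
    Nat.card_congr e.abelianizationCongr.toEquiv
  have hsurj := g.rangeRestrict_surjective
  have h2 : commutator g.range = (commutator K).map g.rangeRestrict := by
    rw [_root_.commutator_def, _root_.commutator_def, Subgroup.map_commutator,
      ← MonoidHom.range_eq_map,
      MonoidHom.range_eq_top.2 hsurj]
  rw [h1, ← Subgroup.index_comap_of_surjective _ hsurj, h2, Subgroup.comap_map_eq,
    MonoidHom.ker_rangeRestrict]
  congr 2
  rw [← MonoidHom.comap_ker, QuotientGroup.ker_mk']

/-! ### Monomial groups over an abelian group -/

section Monomial

open scoped commutatorElement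

variable {ι C : Type*} [Fintype ι] [CommGroup C]

/-- The families of elements of `C` with product `1`. -/
def normOneTorus (ι C : Type*) [Fintype ι] [CommGroup C] : Subgroup (ι → C) where
  carrier := {t | ∏ i, t i = 1}
  mul_mem' {s t} hs ht := by
    simp only [Set.mem_ofPred_eq] at hs ht ⊢
    simp [Finset.prod_mul_distrib, hs, ht]
  one_mem' := by simp
  inv_mem' {t} ht := by
    simp only [Set.mem_ofPred_eq] at ht ⊢
    simp [ht]

theorem mem_normOneTorus {t : ι → C} : t ∈ normOneTorus ι C ↔ ∏ i, t i = 1 := Iff.rfl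

/-- The action of permutations on `normOneTorus ι C`: the entry of `t` at `i` moves to `σ i`. -/
@[simps]
def permTorus (ι C : Type*) [Fintype ι] [CommGroup C] :
    Equiv.Perm ι →* MulAut (normOneTorus ι C) where
  toFun σ :=
    { toFun t := ⟨fun i => t.1 (σ⁻¹ i), by
        rw [mem_normOneTorus, Equiv.prod_comp σ⁻¹ t.1]; exact t.2⟩
      invFun t := ⟨fun i => t.1 (σ i), by
        rw [mem_normOneTorus, Equiv.prod_comp σ t.1]; exact t.2⟩
      left_inv t := by ext i; simp
      right_inv t := by ext i; simp
      map_mul' s t := by ext i; simp }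
  map_one' := by ext t i; simp
  map_mul' σ τ := by ext t i; simp

/-- The abstract group of monomial matrices with permutation part in `P` whose nonzero entries lie
in `C` and have product `1`. For `P` in the alternating group these are matrices of
determinant `1`. -/
abbrev MonomialGroup (C : Type*) [CommGroup C] (P : Subgroup (Equiv.Perm ι)) : Type _ :=
  normOneTorus ι C ⋊[(permTorus ι C).comp P.subtype] P

theorem card_normOneTorus [Nonempty ι] [Finite C] :
    Nat.card (normOneTorus ι C) = Nat.card C ^ (Fintype.card ι - 1) := by
  classical
  let f : (ι → C) →* C :=
    { toFun t := ∏ i, t i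
      map_one' := by simp
      map_mul' s t := by simp [Finset.prod_mul_distrib] }
  have hf : Function.Surjective f := fun c => by
    obtain ⟨i⟩ := ‹Nonempty ι›
    exact ⟨Pi.mulSingle i c, by simp [f]⟩
  have hk : f.ker = normOneTorus ι C := rfl
  have h := f.ker.card_mul_index
  rw [Subgroup.index_ker, MonoidHom.range_eq_top.2 hf, Subgroup.card_top, hk,
    Nat.card_fun, Nat.card_eq_fintype_card (α := ι)] at h
  have hpos : 0 < Nat.card C := Nat.card_pos
  have hι : Fintype.card ι = Fintype.card ι - 1 + 1 := by
    have : 0 < Fintype.card ι := Fintype.card_pos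
    omega
  rw [hι, pow_succ] at h
  exact Nat.eq_of_mul_eq_mul_right hpos h

/-- The family with entry `c` at `i`, entry `c⁻¹` at `j` and all other entries `1`. -/
def torusPair [DecidableEq ι] (i j : ι) (c : C) : normOneTorus ι C :=
  ⟨Pi.mulSingle i c * Pi.mulSingle j c⁻¹, by
    simp [mem_normOneTorus, Finset.prod_mul_distrib]⟩

theorem torusPair_left [DecidableEq ι] {i j : ι} (h : i ≠ j) (c : C) :
    (torusPair i j c).1 i = c := by
  simp [torusPair, h]

theorem torusPair_of_ne [DecidableEq ι] {i j k : ι} (hi : k ≠ i) (hj : k ≠ j) (c : C) :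
    (torusPair i j c).1 k = 1 := by
  simp [torusPair, hi, hj]

/-- If `ι` has at least three elements, permutations act faithfully on `normOneTorus ι C`. -/
theorem eq_one_of_permTorus_eq [Nontrivial C] (hι : 3 ≤ Fintype.card ι) {σ : Equiv.Perm ι}
    (h : ∀ t, permTorus ι C σ t = t) : σ = 1 := by
  classical
  obtain ⟨c, hc⟩ := exists_ne (1 : C)
  by_contra hσ
  obtain ⟨i, hi⟩ : ∃ i, σ i ≠ i := by
    by_contra! H; exact hσ (Equiv.ext H)
  obtain ⟨l, hl⟩ : ∃ l, l ∉ ({i, σ i} : Finset ι) := by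
    by_contra! H
    have : Finset.univ ⊆ ({i, σ i} : Finset ι) := fun x _ => H x
    have := (Finset.card_le_card this).trans Finset.card_le_two
    rw [Finset.card_univ] at this; omega
  simp only [Finset.mem_insert, Finset.mem_singleton, not_or] at hl
  have := congrFun (congrArg Subtype.val (h (torusPair i l c))) (σ i)
  simp only [permTorus_apply_apply_coe] at this
  rw [show σ⁻¹ (σ i) = i from σ.symm_apply_apply i] at this
  rw [torusPair_left (Ne.symm hl.1), torusPair_of_ne hi (Ne.symm hl.2)] at this
  exact hc this

/-- The centre of the monomial group with even permutation part consists of scalars. -/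
theorem MonomialGroup.scalar_of_mem_center [DecidableEq ι] [Nontrivial C] (hι : 3 ≤ Fintype.card ι)
    {x : MonomialGroup C (alternatingGroup ι)} (hx : x ∈ Subgroup.center _) :
    x.right = 1 ∧ ∃ c, ∀ i, x.left.1 i = c := by
  rw [Subgroup.mem_center_iff] at hx
  have h1 : x.right = 1 := by
    apply Subtype.ext
    refine eq_one_of_permTorus_eq (C := C) hι fun t => ?_
    have := congrArg SemidirectProduct.left (hx (SemidirectProduct.inl t))
    simp only [SemidirectProduct.mul_left, SemidirectProduct.left_inl,
      SemidirectProduct.right_inl, map_one, MulAut.one_apply] at this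
    rw [mul_comm] at this
    exact (mul_left_cancel this).symm
  refine ⟨h1, ?_⟩
  obtain ⟨i₀⟩ : Nonempty ι := Fintype.card_pos_iff.1 (by omega)
  refine ⟨x.left.1 i₀, fun j => ?_⟩
  by_cases hj : j = i₀
  · rw [hj]
  obtain ⟨l, hl⟩ : ∃ l, l ∉ ({i₀, j} : Finset ι) := by
    by_contra! H
    have : Finset.univ ⊆ ({i₀, j} : Finset ι) := fun x _ => H x
    have := (Finset.card_le_card this).trans Finset.card_le_two
    rw [Finset.card_univ] at this; omega
  simp only [Finset.mem_insert, Finset.mem_singleton, not_or] at hl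
  let τ : alternatingGroup ι := ⟨Equiv.swap l i₀ * Equiv.swap l j,
    (Equiv.Perm.isThreeCycle_swap_mul_swap_same hl.1 hl.2 (Ne.symm hj)).mem_alternatingGroup⟩
  have h2 := congrArg SemidirectProduct.left (hx (SemidirectProduct.inr τ⁻¹))
  simp only [SemidirectProduct.mul_left, SemidirectProduct.left_inr, one_mul,
      SemidirectProduct.right_inr, map_one, mul_one] at h2
  have h3 := congrFun (congrArg Subtype.val h2) j
  have hτ : τ.1 j = i₀ := by simp [τ]
  simp only [MonoidHom.comp_apply, Subgroup.subtype_apply, permTorus_apply_apply_coe,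
    InvMemClass.coe_inv, inv_inv] at h3
  rw [hτ] at h3
  exact h3.symm

end Monomial

/-! ### The derived subgroup of a monomial group -/

section MonomialIndex

open scoped commutatorElement

variable {ι C : Type*} [Fintype ι] [CommGroup C] {P : Subgroup (Equiv.Perm ι)}

instance [Finite C] : Finite (MonomialGroup C P) :=
  Finite.of_equiv _ SemidirectProduct.equivProd.symm

theorem MonomialGroup.card_eq [Nonempty ι] [Finite C] :
    Nat.card (MonomialGroup C P) = Nat.card C ^ (Fintype.card ι - 1) * Nat.card P := by
  rw [Nat.card_congr SemidirectProduct.equivProd, Nat.card_prod, card_normOneTorus]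

/-- The derived subgroup of the monomial group, together with scalars, does not contain the
diagonal part; hence its index exceeds that for the permutation part. -/
theorem MonomialGroup.index_commutator_lt [Finite C] [Nontrivial C]
    [Group.IsNilpotent (MonomialGroup C P)] (hι : 3 ≤ Fintype.card ι)
    {Z : Subgroup (MonomialGroup C P)} [Z.Normal]
    (hZ : ∀ x ∈ Z, x.right = 1 ∧ ∃ c, ∀ i, x.left.1 i = c) :
    (commutator P).index < (commutator (MonomialGroup C P) ⊔ Z).index := by
  classical
  set K := MonomialGroup C P
  let A : Subgroup K := SemidirectProduct.rightHom.ker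
  have hA : A = (SemidirectProduct.inl : normOneTorus ι C →* K).range :=
    SemidirectProduct.range_inl_eq_ker_rightHom.symm
  have hcomm : IsMulCommutative A := by
    refine ⟨⟨fun x y => ?_⟩⟩
    obtain ⟨s, hs⟩ : x.1 ∈ (SemidirectProduct.inl : normOneTorus ι C →* K).range := hA ▸ x.2
    obtain ⟨t, ht⟩ : y.1 ∈ (SemidirectProduct.inl : normOneTorus ι C →* K).range := hA ▸ y.2
    apply Subtype.ext
    rw [Subgroup.coe_mul, Subgroup.coe_mul, ← hs, ← ht, ← map_mul, ← map_mul, mul_comm]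
  let R : Subgroup K := (SemidirectProduct.inr : P →* K).range
  have hsup : A ⊔ R = ⊤ := by
    rw [eq_top_iff]
    intro x _
    rw [← SemidirectProduct.inl_left_mul_inr_right x]
    exact Subgroup.mul_mem_sup (hA ▸ ⟨_, rfl⟩) ⟨_, rfl⟩
  have hinf : A ⊓ R = ⊥ := by
    rw [eq_bot_iff]
    rintro _ ⟨h1, σ, rfl⟩
    have : σ = 1 := h1
    simp [this]
  have hZA : Z ≤ A := fun x hx => (hZ x hx).1
  have hAZ : ¬ A ≤ Z := by
    intro h
    obtain ⟨c, hc⟩ := exists_ne (1 : C)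
    obtain ⟨i, j, k, hij, hik, hjk⟩ := Fintype.two_lt_card_iff.1 (show 2 < Fintype.card ι by omega)
    have hm : SemidirectProduct.inl (torusPair i j c) ∈ Z := h (SemidirectProduct.rightHom_inl _)
    obtain ⟨-, d, hd⟩ := hZ _ hm
    have h1 := hd i
    have h2 := hd k
    rw [SemidirectProduct.left_inl] at h1 h2
    rw [torusPair_left hij] at h1
    rw [torusPair_of_ne hik.symm hjk.symm] at h2
    exact hc (h1.trans h2.symm)
  have hnot := Group.not_le_commutator_sup hcomm hsup hinf hZA hAZ
  -- The index of `K' A` is that of `P'` in `P`, and `K' Z` is properly contained in `K' A`.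
  have hlt : commutator K ⊔ Z < commutator K ⊔ A :=
    lt_of_le_of_ne (sup_le_sup_left hZA _) fun h => hnot (h ▸ le_sup_right)
  refine lt_of_le_of_lt ?_ (Subgroup.index_strictAnti hlt)
  refine Group.card_le_index_commutator_sup
    ((Abelianization.of : P →* Abelianization P).comp SemidirectProduct.rightHom) ?_ ?_
  · exact Function.Surjective.comp (g := Abelianization.of (G := P)) QuotientGroup.mk_surjective
      SemidirectProduct.rightHom_surjective
  · intro x hx
    rw [MonoidHom.mem_ker, MonoidHom.comp_apply, show SemidirectProduct.rightHom x = 1 from hx,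
      map_one]

/-- The entries at points fixed by `P` are characters of the monomial group. The point `i₀`
is needed to correct the product of the entries to `1`. -/
theorem MonomialGroup.pow_mul_le_index_commutator [Finite C] {J : Type*} [Finite J]
    (e : J ↪ ι) (he : ∀ σ ∈ P, ∀ j, σ (e j) = e j) {i₀ : ι} (hi₀ : ∀ j, e j ≠ i₀) :
    Nat.card C ^ Nat.card J * (commutator P).index ≤ (commutator (MonomialGroup C P)).index := by
  classical
  let θ : MonomialGroup C P →* (J → C) × Abelianization P :=
    { toFun x := (fun j => x.left.1 (e j), Abelianization.of x.right)
      map_one' := by ext <;> simp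
      map_mul' x y := by
        have h (j) : (x.right : Equiv.Perm ι)⁻¹ (e j) = e j := he _ (inv_mem x.right.2) j
        ext <;> simp [h] }
  have hθ : Function.Surjective θ := by
    rintro ⟨u, s⟩
    obtain ⟨σ, rfl⟩ :=
      (QuotientGroup.mk_surjective : Function.Surjective (Abelianization.of (G := P))) s
    let v : ι → C := Function.extend e u 1
    refine ⟨⟨⟨v * Pi.mulSingle i₀ (∏ i, v i)⁻¹, ?_⟩, σ⟩, ?_⟩
    · simp [mem_normOneTorus, Finset.prod_mul_distrib]
    · refine Prod.ext (funext fun j => ?_) rfl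
      simp [θ, v, e.injective.extend_apply, hi₀]
  have := Group.card_le_index_commutator_sup θ hθ (bot_le (a := θ.ker))
  rwa [sup_bot_eq, Nat.card_prod, Nat.card_fun] at this

/-- The commutators of `σ` with diagonal elements form a subgroup of order `|T| / |T^σ|`, with
`T^σ` the fixed points of `σ` on the diagonal part `T`. -/
theorem MonomialGroup.index_commutator_le [Finite C] (σ : P) :
    (commutator (MonomialGroup C P)).index ≤
      Nat.card {t : normOneTorus ι C // permTorus ι C σ t = t} * Nat.card P := by
  classical
  set K := MonomialGroup C P
  let δ : normOneTorus ι C →* normOneTorus ι C :=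
    { toFun t := permTorus ι C σ t * t⁻¹
      map_one' := by simp
      map_mul' s t := by rw [map_mul, mul_inv, mul_mul_mul_comm] }
  let f : normOneTorus ι C →* K := SemidirectProduct.inl.comp δ
  have hf : f.range ≤ commutator K := by
    rintro _ ⟨t, rfl⟩
    have : f t = ⁅(SemidirectProduct.inr σ : K), SemidirectProduct.inl t⁆ := by
      simp only [f, δ, MonoidHom.comp_apply, MonoidHom.coe_mk, OneHom.coe_mk, map_mul,
        commutatorElement_def, map_inv]
      rw [show permTorus ι C σ t = ((permTorus ι C).comp P.subtype) σ t from rfl,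
        SemidirectProduct.inl_aut]
      simp
    rw [this]
    exact Subgroup.commutator_mem_commutator (Subgroup.mem_top _) (Subgroup.mem_top _)
  refine (Subgroup.index_antitone hf).trans (le_of_eq ?_)
  have h1 := f.range.card_mul_index
  have h2 := f.ker.card_mul_index
  rw [Subgroup.index_ker] at h2
  have h3 : Nat.card K = Nat.card (normOneTorus ι C) * Nat.card P := by
    rw [Nat.card_congr SemidirectProduct.equivProd, Nat.card_prod]
  have h4 : Nat.card f.ker = Nat.card {t : normOneTorus ι C // permTorus ι C σ t = t} := by
    refine Nat.card_congr (Equiv.subtypeEquivRight fun t => ?_)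
    rw [MonoidHom.mem_ker, MonoidHom.comp_apply,
      ← map_one (SemidirectProduct.inl : normOneTorus ι C →* K), SemidirectProduct.inl_inj]
    exact mul_inv_eq_one
  have hpos : 0 < Nat.card f.range := Nat.card_pos
  apply Nat.eq_of_mul_eq_mul_left hpos
  rw [h1, h3, ← h2, ← h4]
  ring

end MonomialIndex

/-! ### Sylow 3-subgroups of symmetric groups -/

section PermutationSubgroups

theorem IsPGroup.le_alternatingGroup {ι : Type*} [Fintype ι] [DecidableEq ι]
    {P : Subgroup (Equiv.Perm ι)} (hP : IsPGroup 3 P) : P ≤ alternatingGroup ι := by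
  intro σ hσ
  obtain ⟨k, hk⟩ := hP ⟨σ, hσ⟩
  have hk' : σ ^ 3 ^ k = 1 := congrArg Subtype.val hk
  have h := congrArg Equiv.Perm.sign hk'
  rw [map_pow, map_one] at h
  rw [Equiv.Perm.mem_alternatingGroup]
  rcases Int.units_eq_one_or (Equiv.Perm.sign σ) with h1 | h1
  · exact h1
  · rw [h1, Odd.neg_one_pow (Odd.pow (by decide))] at h
    exact h.symm ▸ h1

/-- On at least six points, the group generated by two disjoint 3-cycles prevents a suitable, and
hence each, Sylow 3-subgroup of the symmetric group from being cyclic. -/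
theorem Equiv.Perm.exists_sylow_three_not_isCyclic {n : ℕ} (hn : 6 ≤ n) :
    ∃ P : Sylow 3 (Equiv.Perm (Fin n)), ¬ IsCyclic P := by
  have h (i : ℕ) (hi : i < 6) : i < n := by omega
  let x (i : Fin 6) : Fin n := ⟨i, h i i.2⟩
  have hx : Function.Injective x := fun i j hij =>
    Fin.ext (congrArg Fin.val hij : (x i).val = (x j).val)
  have hne {i j : Fin 6} (hij : i ≠ j) : x i ≠ x j := hx.ne hij
  let c : Equiv.Perm (Fin n) := Equiv.swap (x 0) (x 1) * Equiv.swap (x 0) (x 2)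
  let d : Equiv.Perm (Fin n) := Equiv.swap (x 3) (x 4) * Equiv.swap (x 3) (x 5)
  have hc : orderOf c = 3 := (Equiv.Perm.isThreeCycle_swap_mul_swap_same
    (hne (by decide)) (hne (by decide)) (hne (by decide))).orderOf
  have hd : orderOf d = 3 := (Equiv.Perm.isThreeCycle_swap_mul_swap_same
    (hne (by decide)) (hne (by decide)) (hne (by decide))).orderOf
  have hswap {i j k l : Fin 6} (h : [i, j, k, l].Nodup) :
      (Equiv.swap (x i) (x j)).Disjoint (Equiv.swap (x k) (x l)) := by
    refine Equiv.Perm.disjoint_swap_swap ?_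
    exact List.Nodup.map (f := x) hx h
  have hdis : c.Disjoint d :=
    .mul_left (.mul_right (hswap (by decide)) (hswap (by decide)))
      (.mul_right (hswap (by decide)) (hswap (by decide)))
  have hcp : IsPGroup 3 (Subgroup.zpowers c) :=
    .of_card (n := 1) (by rw [Nat.card_zpowers, hc, pow_one])
  have hdp : IsPGroup 3 (Subgroup.zpowers d) :=
    .of_card (n := 1) (by rw [Nat.card_zpowers, hd, pow_one])
  have hE : IsPGroup 3 (Subgroup.zpowers c ⊔ Subgroup.zpowers d : Subgroup _) := by
    refine hcp.to_sup_of_normal_right' hdp ?_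
    rw [Subgroup.zpowers_le]
    refine Subgroup.centralizer_le_normalizer _ (Subgroup.mem_centralizer_iff.2 ?_)
    rintro _ ⟨k, rfl⟩
    exact (hdis.commute.symm.zpow_left k).eq
  obtain ⟨P, hP⟩ := hE.exists_le_sylow
  refine ⟨P, fun hcyc => ?_⟩
  have hcP : c ∈ P := hP (Subgroup.mem_sup_left (Subgroup.mem_zpowers c))
  have hdP : d ∈ P := hP (Subgroup.mem_sup_right (Subgroup.mem_zpowers d))
  have hc3 : c ^ 3 = 1 := hc ▸ pow_orderOf_eq_one c
  have hd3 : d ^ 3 = 1 := hd ▸ pow_orderOf_eq_one d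
  have hc0 : c (x 0) = x 2 := by
    have h1 := hne (i := 2) (j := 0) (by decide)
    have h2 := hne (i := 2) (j := 1) (by decide)
    simp [c, Equiv.swap_apply_of_ne_of_ne h1 h2]
  have hc2 : c (x 2) = x 1 := by simp [c]
  have hd0 : d (x 0) = x 0 := (hdis (x 0)).resolve_left (hc0 ▸ hne (by decide))
  have := Fintype.ofFinite P
  have hle := IsCyclic.card_pow_eq_one_le (α := P) (n := 3) (by norm_num)
  let c' : P := ⟨c, hcP⟩
  let d' : P := ⟨d, hdP⟩
  -- A cyclic group has at most three solutions of `x ^ 3 = 1`, but `1, c, c ^ 2, d` are four.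
  have hsub : ({1, c', c' ^ 2, d'} : Finset P) ⊆ Finset.univ.filter fun a => a ^ 3 = 1 := by
    intro y hy
    simp only [Finset.mem_insert, Finset.mem_singleton] at hy
    have hc3' : c' ^ 3 = 1 := Subtype.ext hc3
    have hd3' : d' ^ 3 = 1 := Subtype.ext hd3
    rcases hy with rfl | rfl | rfl | rfl
    · simp
    · simpa using hc3'
    · simp [← pow_mul, mul_comm 2 3, pow_mul _ 3 2, hc3']
    · simpa using hd3'
  have hcard : ({1, c', c' ^ 2, d'} : Finset P).card = 4 := by
    have key {u v : P} (h : u.1 (x 0) ≠ v.1 (x 0)) : u ≠ v := fun H => h (H ▸ rfl)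
    have hcc : (c' ^ 2).1 (x 0) = x 1 := by
      change (c ^ 2) (x 0) = x 1
      rw [pow_two, Equiv.Perm.mul_apply, hc0, hc2]
    have h1d : (1 : P) ≠ d' := fun H => by
      have : d = 1 := (congrArg Subtype.val H).symm
      rw [this, orderOf_one] at hd
      omega
    have h1c : (1 : P) ≠ c' := key (by change x 0 ≠ c (x 0); rw [hc0]; exact hne (by decide))
    have h1cc : (1 : P) ≠ c' ^ 2 := key (by rw [hcc]; exact hne (i := 0) (by decide))
    have h2 : c' ≠ c' ^ 2 := key (by rw [hcc]; change c (x 0) ≠ _; rw [hc0]; exact hne (by decide))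
    have h3 : c' ≠ d' := key (by change c (x 0) ≠ d (x 0); rw [hc0, hd0]; exact hne (by decide))
    have h4 : c' ^ 2 ≠ d' := key (by rw [hcc]; change _ ≠ d (x 0); rw [hd0]; exact hne (by decide))
    rw [Finset.card_insert_of_notMem (by simp [h1d, h1c, h1cc]),
      Finset.card_insert_of_notMem (by simp [h2, h3]), Finset.card_pair h4]
  have := (Finset.card_le_card hsub).trans hle
  omega

end PermutationSubgroups

/-! ### Sylow 3-subgroups of central quotients of groups containing a monomial group -/

section CentralQuotient

/-- A family fixed by the 3-cycle is constant, and its entry has cube `1`. -/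
theorem card_fixed_normOneTorus_three {C : Type*} [CommGroup C] [Finite C] [IsCyclic C] :
    Nat.card {t : normOneTorus (Fin 3) C //
      permTorus (Fin 3) C (Equiv.swap 0 1 * Equiv.swap 0 2) t = t} ≤ 3 := by
  classical
  have := Fintype.ofFinite C
  have hfix (t : {t : normOneTorus (Fin 3) C //
      permTorus (Fin 3) C (Equiv.swap 0 1 * Equiv.swap 0 2) t = t}) (i : Fin 3) :
      t.1.1 i = t.1.1 0 := by
    have h (i) := congrFun (congrArg Subtype.val t.2) i
    simp only [permTorus_apply_apply_coe] at h
    have h0 := h 0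
    have h1 := h 1
    rw [show (Equiv.swap 0 1 * Equiv.swap 0 2 : Equiv.Perm (Fin 3))⁻¹ 0 = 1 by decide] at h0
    rw [show (Equiv.swap 0 1 * Equiv.swap 0 2 : Equiv.Perm (Fin 3))⁻¹ 1 = 2 by decide] at h1
    fin_cases i
    · rfl
    · exact h0
    · exact h1.trans h0
  let g : {t : normOneTorus (Fin 3) C //
      permTorus (Fin 3) C (Equiv.swap 0 1 * Equiv.swap 0 2) t = t} → {c : C // c ^ 3 = 1} :=
    fun t => ⟨t.1.1 0, by
      have := mem_normOneTorus.1 t.1.2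
      rw [Finset.prod_congr rfl fun i _ => hfix t i] at this
      simpa using this⟩
  have hg : Function.Injective g := fun s t hst => by
    apply Subtype.ext; apply Subtype.ext; funext i
    rw [hfix s, hfix t]; exact congrArg Subtype.val hst
  refine (Nat.card_le_card_of_injective g hg).trans ?_
  rw [Nat.card_eq_fintype_card, Fintype.card_subtype]
  exact IsCyclic.card_pow_eq_one_le (by norm_num)

/-- A family fixed by the 3-cycle is determined by its entry at a point moved by the 3-cycle. -/
theorem card_fixed_normOneTorus_four {C : Type*} [CommGroup C] [Finite C] :
    Nat.card {t : normOneTorus (Fin 4) C //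
      permTorus (Fin 4) C (Equiv.swap 0 1 * Equiv.swap 0 2) t = t} ≤ Nat.card C := by
  refine Nat.card_le_card_of_injective (fun t => t.1.1 0) fun s t (hst : s.1.1 0 = t.1.1 0) => ?_
  have hfix (t : {t : normOneTorus (Fin 4) C //
      permTorus (Fin 4) C (Equiv.swap 0 1 * Equiv.swap 0 2) t = t}) :
      t.1.1 1 = t.1.1 0 ∧ t.1.1 2 = t.1.1 0 := by
    have h (i) := congrFun (congrArg Subtype.val t.2) i
    simp only [permTorus_apply_apply_coe] at h
    have h0 := h 0
    have h1 := h 1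
    rw [show (Equiv.swap 0 1 * Equiv.swap 0 2 : Equiv.Perm (Fin 4))⁻¹ 0 = 1 by decide] at h0
    rw [show (Equiv.swap 0 1 * Equiv.swap 0 2 : Equiv.Perm (Fin 4))⁻¹ 1 = 2 by decide] at h1
    exact ⟨h0, h1.trans h0⟩
  have hs := mem_normOneTorus.1 s.1.2
  have ht := mem_normOneTorus.1 t.1.2
  rw [Fin.prod_univ_four, (hfix _).1, (hfix _).2] at hs ht
  apply Subtype.ext; apply Subtype.ext; funext i
  fin_cases i
  · exact hst
  · exact ((hfix s).1.trans hst).trans (hfix t).1.symm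
  · exact ((hfix s).2.trans hst).trans (hfix t).2.symm
  · rw [hst, ← ht] at hs
    exact mul_left_cancel hs


variable {ι C : Type*} [Fintype ι] [CommGroup C]

/-- The inclusion of monomial groups belonging to an inclusion of permutation groups. -/
def MonomialGroup.inclusion (C : Type*) [CommGroup C] {P R : Subgroup (Equiv.Perm ι)}
    (h : P ≤ R) : MonomialGroup C P →* MonomialGroup C R :=
  SemidirectProduct.map (MonoidHom.id _) (Subgroup.inclusion h) (fun _ => rfl)

theorem MonomialGroup.inclusion_injective {P R : Subgroup (Equiv.Perm ι)} (h : P ≤ R) :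
    Function.Injective (MonomialGroup.inclusion C h) := by
  intro x y hxy
  refine SemidirectProduct.ext ?_ (Subgroup.inclusion_injective h ?_)
  · exact (congrArg SemidirectProduct.left hxy :
      (MonomialGroup.inclusion C h x).left = (MonomialGroup.inclusion C h y).left)
  · exact (congrArg SemidirectProduct.right hxy :
      (MonomialGroup.inclusion C h x).right = (MonomialGroup.inclusion C h y).right)

variable {G : Type*} [Group G] [Finite G]

/-- If `G` contains the monomial group over `C` with even permutations, and the monomial group
with permutation part a Sylow 3-subgroup has the full 3-part of the order of `G`, then the derived
subgroup of a Sylow 3-subgroup of `G ⧸ center G` is computed in the latter. All even permutations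
are used to show that the central elements it contains are scalars. -/
theorem MonomialGroup.index_commutator_sylow [DecidableEq ι] [Finite C] [Nontrivial C] {a : ℕ}
    (hC : Nat.card C = 3 ^ a) (hι : 3 ≤ Fintype.card ι)
    {κ : MonomialGroup C (alternatingGroup ι) →* G} (hκ : Function.Injective κ)
    (hG : (Nat.card G).factorization 3 ≤
      a * (Fintype.card ι - 1) + (Fintype.card ι).factorial.factorization 3)
    {P : Subgroup (Equiv.Perm ι)} (hP : Nat.card P = 3 ^ (Fintype.card ι).factorial.factorization 3)
    (Q : Sylow 3 (G ⧸ Subgroup.center G)) :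
    ∃ Z : Subgroup (MonomialGroup C P), Z.Normal ∧
      (∀ x ∈ Z, x.right = 1 ∧ ∃ c, ∀ i, x.left.1 i = c) ∧
      (commutator Q).index = (commutator (MonomialGroup C P) ⊔ Z).index := by
  have hle : P ≤ alternatingGroup ι := (IsPGroup.of_card hP).le_alternatingGroup
  have : Nonempty ι := Fintype.card_pos_iff.1 (by omega)
  let f : MonomialGroup C P →* G := κ.comp (MonomialGroup.inclusion C hle)
  have hf : Function.Injective f := hκ.comp (MonomialGroup.inclusion_injective hle)
  have hcard : Nat.card (MonomialGroup C P) =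
      3 ^ (a * (Fintype.card ι - 1) + (Fintype.card ι).factorial.factorization 3) := by
    rw [MonomialGroup.card_eq, hC, hP, ← pow_mul, pow_add]
  have hdvd : Nat.card (MonomialGroup C P) ∣ Nat.card G := Subgroup.card_dvd_of_injective f hf
  have hge : a * (Fintype.card ι - 1) + (Fintype.card ι).factorial.factorization 3 ≤
      (Nat.card G).factorization 3 :=
    (Nat.prime_three.pow_dvd_iff_le_factorization Nat.card_pos.ne').1 (hcard ▸ hdvd)
  refine ⟨(Subgroup.center G).comap f, inferInstance, fun x hx => ?_,
    Sylow.index_commutator_quotient _ f hf (by rw [hcard, le_antisymm hG hge]) Q⟩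
  have hx' : MonomialGroup.inclusion C hle x ∈ Subgroup.center _ := by
    rw [Subgroup.mem_center_iff]
    intro y
    apply hκ
    rw [map_mul, map_mul]
    exact Subgroup.mem_center_iff.1 hx (κ y)
  obtain ⟨h1, h2⟩ := MonomialGroup.scalar_of_mem_center hι hx'
  exact ⟨Subgroup.inclusion_injective hle h1, h2⟩

/-- The criterion for every finite group `G` that contains the monomial group with even
permutation part and whose order has no larger 3-part than that of `SL_n`. -/
theorem index_commutator_sylow_eq_nine_iff [Finite C] [IsCyclic C] {a n : ℕ} (ha : 1 ≤ a)
    (hC : Nat.card C = 3 ^ a) (hn : 3 ≤ n)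
    {κ : MonomialGroup C (alternatingGroup (Fin n)) →* G} (hκ : Function.Injective κ)
    (hG : (Nat.card G).factorization 3 ≤ a * (n - 1) + n.factorial.factorization 3)
    (Q : Sylow 3 (G ⧸ Subgroup.center G)) :
    (commutator Q).index = 9 ↔ n = 3 ∨ (n = 4 ∧ a = 1) := by
  have hι : 3 ≤ Fintype.card (Fin n) := by simpa using hn
  have hC3 : 3 ≤ Nat.card C := hC ▸ Nat.le_self_pow (by omega) 3
  have : Nontrivial C := Finite.one_lt_card_iff_nontrivial.1 (by omega)
  have hidx (P : Subgroup (Equiv.Perm (Fin n)))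
      (hP : Nat.card P = 3 ^ n.factorial.factorization 3) :=
    MonomialGroup.index_commutator_sylow (P := P) hC hι hκ (by simpa using hG) (by simpa using hP) Q
  have hnil (P : Subgroup (Equiv.Perm (Fin n)))
      (hP : Nat.card P = 3 ^ n.factorial.factorization 3) :
      IsPGroup 3 (MonomialGroup C P) := by
    have : Nonempty (Fin n) := ⟨⟨0, by omega⟩⟩
    refine IsPGroup.of_card (n := a * (n - 1) + n.factorial.factorization 3) ?_
    rw [MonomialGroup.card_eq, hC, hP, ← pow_mul, pow_add, Fintype.card_fin]
  rcases le_or_gt 6 n with h6 | h6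
  · obtain ⟨P, hP⟩ := Equiv.Perm.exists_sylow_three_not_isCyclic h6
    have hcard : Nat.card P = 3 ^ n.factorial.factorization 3 := by
      rw [P.card_eq_multiplicity, Nat.card_perm, Nat.card_fin]
    obtain ⟨Z, hZn, hZ, h⟩ := hidx P hcard
    have := (hnil P hcard).isNilpotent
    have h1 := MonomialGroup.index_commutator_lt hι hZ
    have h2 := P.isPGroup'.sq_le_index_commutator hP
    omega
  · -- Now `P` is generated by a 3-cycle.
    have hfac : n.factorial.factorization 3 = 1 := by
      rw [Nat.factorization_def _ Nat.prime_three,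
        padicValNat_factorial (b := 2) (Nat.log_lt_of_lt_pow (by omega) (by omega))]
      simp
      omega
    have key (c : Equiv.Perm (Fin n)) (hc : orderOf c = 3) :
        Nat.card (Subgroup.zpowers c) = 3 ^ n.factorial.factorization 3 ∧
          (commutator (Subgroup.zpowers c)).index = 3 := by
      rw [hfac, Nat.card_zpowers, hc]
      have : commutator (Subgroup.zpowers c) = ⊥ := by
        rw [_root_.commutator_def, Subgroup.commutator_self_eq_bot_iff]
        infer_instance
      rw [this, Subgroup.index_bot, Nat.card_zpowers, hc]
      simp
    have hthree (m : ℕ) :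
        orderOf (Equiv.swap 0 1 * Equiv.swap 0 2 : Equiv.Perm (Fin (m + 3))) = 3 := by
      refine (Equiv.Perm.isThreeCycle_swap_mul_swap_same ?_ ?_ ?_).orderOf
      all_goals
        rw [Ne, Fin.ext_iff]
        simp [Nat.mod_eq_of_lt]
    -- A scalar of determinant `1` and of 3-power order is trivial if `3` does not divide `n`.
    have hscalar (h3 : n.Coprime 3) {P : Subgroup (Equiv.Perm (Fin n))}
        {Z : Subgroup (MonomialGroup C P)}
        (hZ : ∀ x ∈ Z, x.right = 1 ∧ ∃ c, ∀ i, x.left.1 i = c) : Z = ⊥ := by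
      rw [eq_bot_iff]
      intro x hx
      obtain ⟨h1, c, hc⟩ := hZ x hx
      have hcn : c ^ n = 1 := by
        have := mem_normOneTorus.1 x.left.2
        rw [Finset.prod_congr rfl fun i _ => hc i] at this
        simpa using this
      have hca : c ^ 3 ^ a = 1 := hC ▸ pow_card_eq_one'
      have hc1 : c = 1 := by
        rw [← orderOf_eq_one_iff]
        exact Nat.eq_one_of_dvd_coprimes (h3.pow_right a) (orderOf_dvd_of_pow_eq_one hcn)
          (orderOf_dvd_of_pow_eq_one hca)
      rw [Subgroup.mem_bot]
      refine SemidirectProduct.ext (Subtype.ext (funext fun i => ?_)) h1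
      rw [hc i, hc1]
      rfl
    obtain rfl | rfl | rfl : n = 3 ∨ n = 4 ∨ n = 5 := by omega
    · obtain ⟨hcard, hidxP⟩ := key _ (hthree 0)
      obtain ⟨Z, hZn, hZ, h⟩ := hidx _ hcard
      have hp := hnil _ hcard
      have := hp.isNilpotent
      have h1 := MonomialGroup.index_commutator_lt hι hZ
      obtain ⟨k, hk⟩ := hp.index (commutator _ ⊔ Z)
      have h2 := (Subgroup.index_antitone (le_sup_left (b := Z))).trans
        (MonomialGroup.index_commutator_le (C := C) (⟨_, Subgroup.mem_zpowers _⟩ :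
          Subgroup.zpowers (Equiv.swap 0 1 * Equiv.swap 0 2 : Equiv.Perm (Fin 3))))
      have h3 := card_fixed_normOneTorus_three (C := C)
      rw [hcard, hfac] at h2
      rw [hidxP] at h1
      have h4 : (commutator Q).index ≤ 9 := h ▸ h2.trans (Nat.mul_le_mul_right _ h3)
      have h5 : 1 < k := by
        rw [hk] at h1
        exact (Nat.pow_lt_pow_iff_right (a := 3) (by norm_num)).1 (by simpa using h1)
      have h6 : 3 ^ 2 ≤ 3 ^ k := Nat.pow_le_pow_right (by norm_num) h5
      simp only [true_or, iff_true]
      omega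
    · obtain ⟨hcard, hidxP⟩ := key _ (hthree 1)
      obtain ⟨Z, hZn, hZ, h⟩ := hidx _ hcard
      rw [hscalar (by norm_num) hZ, sup_bot_eq] at h
      have h2 := MonomialGroup.index_commutator_le (C := C) (⟨_, Subgroup.mem_zpowers _⟩ :
          Subgroup.zpowers (Equiv.swap 0 1 * Equiv.swap 0 2 : Equiv.Perm (Fin 4)))
      have h3 := card_fixed_normOneTorus_four (C := C)
      have h1 := MonomialGroup.pow_mul_le_index_commutator (C := C)
        (P := Subgroup.zpowers (Equiv.swap 0 1 * Equiv.swap 0 2 : Equiv.Perm (Fin 4)))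
        (⟨fun _ => 3, fun _ _ _ => rfl⟩ : Unit ↪ Fin 4)
        (by
          rintro _ ⟨k, rfl⟩ -
          exact Equiv.Perm.zpow_apply_eq_self_of_apply_eq_self (x := (3 : Fin 4)) (by decide) k)
        (i₀ := 0) (by decide)
      rw [hidxP] at h1
      rw [hcard, hfac] at h2
      rw [← h] at h1 h2
      replace h2 := h2.trans (Nat.mul_le_mul_right _ h3)
      have h4 : (commutator Q).index = 3 ^ (a + 1) := by
        rw [pow_succ, ← hC]
        simp at h1
        omega
      rw [h4, show 9 = 3 ^ 2 by norm_num, Nat.pow_right_inj (by norm_num)]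
      omega
    · obtain ⟨hcard, hidxP⟩ := key _ (hthree 2)
      obtain ⟨Z, hZn, hZ, h⟩ := hidx _ hcard
      rw [hscalar (by norm_num) hZ, sup_bot_eq] at h
      have h1 := MonomialGroup.pow_mul_le_index_commutator (C := C)
        (P := Subgroup.zpowers (Equiv.swap 0 1 * Equiv.swap 0 2 : Equiv.Perm (Fin 5)))
        (⟨fun j => j.natAdd 3, by decide⟩ : Fin 2 ↪ Fin 5)
        (by
          rintro _ ⟨k, rfl⟩ j
          exact Equiv.Perm.zpow_apply_eq_self_of_apply_eq_self (by revert j; decide) k)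
        (i₀ := 0) (by decide)
      rw [hidxP, ← h] at h1
      have h2 : 3 ^ 2 ≤ Nat.card C ^ 2 := Nat.pow_le_pow_left hC3 2
      simp at h1
      omega

end CentralQuotient

/-! ### Orders of matrix groups and monomial matrices -/

section MatrixGroups

variable {F : Type*} [Field F] {n : ℕ}

/-- The order of `SL_n` over a finite field, multiplied by the order of the unit group, is the
order of `GL_n`. -/
theorem Matrix.card_SL_mul_card_units [Finite F] (hn : 1 ≤ n) :
    Nat.card (Matrix.SpecialLinearGroup (Fin n) F) * Nat.card Fˣ = Nat.card (GL (Fin n) F) := by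
  let d : GL (Fin n) F →* Fˣ := Matrix.GeneralLinearGroup.det
  have hd : Function.Surjective d := by
    intro u
    let v : Fin n → Fˣ := Pi.mulSingle ⟨0, hn⟩ u
    have hv : (Matrix.diagonal fun i => (v i : F)).det = u := by
      rw [Matrix.det_diagonal, ← Units.coe_prod]
      simp [v]
    refine ⟨Matrix.GeneralLinearGroup.mkOfDetNeZero (Matrix.diagonal fun i => (v i : F)) ?_, ?_⟩
    · rw [hv]; exact u.ne_zero
    · exact Units.ext hv
  let e : Matrix.SpecialLinearGroup (Fin n) F ≃ d.ker :=
    Equiv.ofBijective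
      (fun A => ⟨Matrix.SpecialLinearGroup.toGL A, by
        rw [MonoidHom.mem_ker]; exact Units.ext A.2⟩)
      ⟨fun A B h => Matrix.SpecialLinearGroup.toGL_injective (congrArg Subtype.val h),
        fun A => ⟨⟨A.1.1, congrArg Units.val (MonoidHom.mem_ker.1 A.2)⟩,
          Subtype.ext (Units.ext rfl)⟩⟩
  rw [Nat.card_congr e, ← d.ker.card_mul_index, Subgroup.index_ker, MonoidHom.range_eq_top.2 hd,
    Subgroup.card_top]

/-- The exponent of `3` in the order of `GL_n` over a field of order `r`, by lifting the
exponent in each factor `r ^ j - 1`. -/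
theorem Nat.factorization_three_prod_pow_sub_pow {r : ℕ} (hr : 1 < r) (h3 : 3 ∣ r - 1) :
    (∏ i : Fin n, (r ^ n - r ^ (i : ℕ))).factorization 3 =
      n * (r - 1).factorization 3 + n.factorial.factorization 3 := by
  have hr3 : ¬ 3 ∣ r := by omega
  have hterm (j : ℕ) : (r ^ (j + 1) - 1).factorization 3 =
      (r - 1).factorization 3 + (j + 1).factorization 3 := by
    have := padicValNat.pow_sub_pow (p := 3) (by decide) hr h3 hr3 (n := j + 1) (by omega)
    simpa [Nat.factorization_def _ Nat.prime_three] using this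
  have hsub (i : ℕ) (hi : i < n) : (r ^ n - r ^ i).factorization 3 =
      (r ^ (n - i) - 1).factorization 3 := by
    have e : r ^ n - r ^ i = r ^ i * (r ^ (n - i) - 1) := by
      rw [Nat.mul_sub, ← pow_add, mul_one, Nat.add_sub_cancel' hi.le]
    have h1 : r ^ i ≠ 0 := by positivity
    have h2 : r ^ (n - i) - 1 ≠ 0 := by
      have := Nat.one_lt_pow (n := n - i) (by omega) hr
      omega
    rw [e, Nat.factorization_mul h1 h2, Finsupp.add_apply, Nat.factorization_pow,
      Finsupp.smul_apply, Nat.factorization_eq_zero_of_not_dvd hr3, smul_zero, zero_add]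
  rw [Fin.prod_univ_eq_prod_range (fun i => r ^ n - r ^ i), Nat.factorization_prod,
    Finsupp.finsetSum_apply]
  · rw [Finset.sum_congr rfl fun i hi => hsub i (Finset.mem_range.1 hi),
      ← Finset.sum_range_reflect]
    rw [Finset.sum_congr rfl (g := fun j => (r - 1).factorization 3 + (j + 1).factorization 3)]
    · rw [Finset.sum_add_distrib, Finset.sum_const, Finset.card_range, smul_eq_mul,
        ← Finset.prod_range_add_one_eq_factorial, Nat.factorization_prod, Finsupp.finsetSum_apply]
      intro j _
      omega
    · intro j hj
      have hj := Finset.mem_range.1 hj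
      rw [← hterm, show n - (n - 1 - j) = j + 1 by omega]
  · intro i hi
    exact Nat.sub_ne_zero_of_lt (Nat.pow_lt_pow_right hr (Finset.mem_range.1 hi))

theorem Matrix.factorization_three_card_SL [Finite F] (hn : 1 ≤ n) (h3 : 3 ∣ Nat.card F - 1) :
    (Nat.card (Matrix.SpecialLinearGroup (Fin n) F)).factorization 3 =
      (Nat.card F - 1).factorization 3 * (n - 1) + n.factorial.factorization 3 := by
  have := Fintype.ofFinite F
  have hr : 1 < Nat.card F := Finite.one_lt_card
  have h := Matrix.card_SL_mul_card_units (F := F) hn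
  have h2 := Nat.factorization_three_prod_pow_sub_pow (n := n) hr h3
  rw [Matrix.card_GL_field, ← Nat.card_eq_fintype_card] at h
  rw [← h, Nat.factorization_mul Nat.card_pos.ne' Nat.card_pos.ne', Finsupp.add_apply,
    Nat.card_units] at h2
  obtain ⟨m, rfl⟩ := Nat.exists_eq_add_of_le' hn
  rw [Nat.add_sub_cancel, mul_comm]
  rw [add_mul] at h2
  omega

/-- The matrix of an element `(t, σ)` of a monomial group: its entry at `(σ j, j)` is `t (σ j)`. -/
def monomialMatrix (C : Subgroup Fˣ) (P : Subgroup (Equiv.Perm (Fin n))) :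
    MonomialGroup C P →* Matrix (Fin n) (Fin n) F where
  toFun x := (Matrix.diagonal fun i => ((x.left.1 i : Fˣ) : F)).submatrix id x.right.1
  map_one' := by ext i j; simp [Matrix.one_apply]
  map_mul' x y := by
    ext i j
    simp only [Matrix.mul_apply, Matrix.submatrix_apply, id_eq, Matrix.diagonal_apply]
    rw [Finset.sum_eq_single (x.right.1⁻¹ i)]
    · have h : i = x.right.1 (y.right.1 j) ↔ x.right.1⁻¹ i = y.right.1 j := by
        rw [Equiv.Perm.inv_eq_iff_eq]
      by_cases hij : x.right.1⁻¹ i = y.right.1 j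
      · simp [h.2 hij]
      · have := mt h.1 hij
        simpa [this] using hij
    · intro k _ hk
      rw [if_neg, zero_mul]
      rintro rfl
      simp at hk
    · simp

theorem monomialMatrix_apply {C : Subgroup Fˣ} {P : Subgroup (Equiv.Perm (Fin n))}
    (x : MonomialGroup C P) : monomialMatrix C P x =
      (Matrix.diagonal fun i => ((x.left.1 i : Fˣ) : F)).submatrix id x.right.1 := rfl

theorem monomialMatrix_injective (C : Subgroup Fˣ) (P : Subgroup (Equiv.Perm (Fin n))) :
    Function.Injective (monomialMatrix C P) := by
  intro x y h
  have hent (i j) := congrFun (congrFun h i) j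
  simp only [monomialMatrix_apply, Matrix.submatrix_apply, id_eq, Matrix.diagonal_apply] at hent
  have hr : x.right = y.right := by
    apply Subtype.ext
    ext1 j
    by_contra hne
    have := hent (x.right.1 j) j
    rw [if_pos rfl, if_neg hne] at this
    exact Units.ne_zero _ this
  refine SemidirectProduct.ext (Subtype.ext (funext fun i => ?_)) hr
  have := hent i (x.right.1⁻¹ i)
  rw [← hr, if_pos (by simp), if_pos (by simp)] at this
  exact Subtype.ext (Units.ext this)

theorem det_monomialMatrix (C : Subgroup Fˣ) (x : MonomialGroup C (alternatingGroup (Fin n))) :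
    (monomialMatrix C _ x).det = 1 := by
  have h := congrArg (fun c : C => ((c : Fˣ) : F)) (mem_normOneTorus.1 x.left.2)
  have hs : Equiv.Perm.sign x.right.1 = 1 := Equiv.Perm.mem_alternatingGroup.1 x.right.2
  rw [monomialMatrix_apply, Matrix.det_permute', Matrix.det_diagonal, hs]
  simpa using h

theorem monomialMatrix_mul_star [StarRing F] {C : Subgroup Fˣ}
    (hC : ∀ c ∈ C, (c : F) * star (c : F) = 1)
    {P : Subgroup (Equiv.Perm (Fin n))} (x : MonomialGroup C P) :
    monomialMatrix C P x * star (monomialMatrix C P x) = 1 := by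
  rw [monomialMatrix_apply, Matrix.star_eq_conjTranspose, Matrix.conjTranspose_submatrix,
    Matrix.submatrix_mul_equiv, Matrix.diagonal_conjTranspose, Matrix.diagonal_mul_diagonal]
  rw [Matrix.submatrix_id_id, ← Matrix.diagonal_one]
  congr 1
  funext i
  exact hC _ (x.left.1 i).2

theorem card_three_torsion_units [Finite F] {a : ℕ} (ha : (Nat.card F - 1).factorization 3 = a) :
    Nat.card (powMonoidHom (3 ^ a) : Fˣ →* Fˣ).ker = 3 ^ a := by
  rw [IsCyclic.card_powMonoidHom_ker, Nat.card_units]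
  exact Nat.gcd_eq_right (ha ▸ Nat.ordProj_dvd _ _)

end MatrixGroups

theorem index_commutator_sylow_SL {F : Type*} [Field F] [Finite F] {n : ℕ} (hn : 3 ≤ n)
    (h3 : 3 ∣ Nat.card F - 1)
    (Q : Sylow 3 (Matrix.SpecialLinearGroup (Fin n) F ⧸
      Subgroup.center (Matrix.SpecialLinearGroup (Fin n) F))) :
    (commutator Q).index = 9 ↔ n = 3 ∨ (n = 4 ∧ (Nat.card F - 1).factorization 3 = 1) := by
  have hr : 1 < Nat.card F := Finite.one_lt_card
  have ha : 1 ≤ (Nat.card F - 1).factorization 3 :=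
    (Nat.prime_three.dvd_iff_one_le_factorization (by omega)).1 h3
  let C : Subgroup Fˣ := (powMonoidHom (3 ^ (Nat.card F - 1).factorization 3)).ker
  let κ : MonomialGroup C (alternatingGroup (Fin n)) →* Matrix.SpecialLinearGroup (Fin n) F :=
    { toFun x := ⟨monomialMatrix C _ x, det_monomialMatrix C x⟩
      map_one' := Subtype.ext (map_one _)
      map_mul' x y := Subtype.ext (map_mul _ x y) }
  have hκ : Function.Injective κ := fun x y h =>
    monomialMatrix_injective _ _ (congrArg Subtype.val h)
  exact index_commutator_sylow_eq_nine_iff ha (card_three_torsion_units rfl) hn hκ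
    (Matrix.factorization_three_card_SL (by omega) h3).le Q

/-- The hypothesis `hstar` says that diagonal matrices of 3-power order are unitary; it makes
the 3-part of `|SU_n|` as large as that of `|SL_n|` over the same field. -/
theorem index_commutator_sylow_SU {F : Type*} [Field F] [StarRing F] [Finite F] {n : ℕ}
    (hn : 3 ≤ n) (h3 : 3 ∣ Nat.card F - 1)
    (hstar : ∀ c : Fˣ, c ^ 3 ^ (Nat.card F - 1).factorization 3 = 1 → (c : F) * star (c : F) = 1)
    (Q : Sylow 3 (Matrix.specialUnitaryGroup (Fin n) F ⧸
      Subgroup.center (Matrix.specialUnitaryGroup (Fin n) F))) :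
    (commutator Q).index = 9 ↔ n = 3 ∨ (n = 4 ∧ (Nat.card F - 1).factorization 3 = 1) := by
  have hr : 1 < Nat.card F := Finite.one_lt_card
  have ha : 1 ≤ (Nat.card F - 1).factorization 3 :=
    (Nat.prime_three.dvd_iff_one_le_factorization (by omega)).1 h3
  let C : Subgroup Fˣ := (powMonoidHom (3 ^ (Nat.card F - 1).factorization 3)).ker
  let κ : MonomialGroup C (alternatingGroup (Fin n)) →* Matrix.specialUnitaryGroup (Fin n) F :=
    { toFun x := ⟨monomialMatrix C _ x, Matrix.mem_specialUnitaryGroup_iff.2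
        ⟨Matrix.mem_unitaryGroup_iff.2 (monomialMatrix_mul_star hstar x), det_monomialMatrix C x⟩⟩
      map_one' := Subtype.ext (map_one _)
      map_mul' x y := Subtype.ext (map_mul _ x y) }
  have hκ : Function.Injective κ := fun x y h =>
    monomialMatrix_injective _ _ (congrArg Subtype.val h)
  let j : Matrix.specialUnitaryGroup (Fin n) F →* Matrix.SpecialLinearGroup (Fin n) F :=
    { toFun A := ⟨A.1, (Matrix.mem_specialUnitaryGroup_iff.1 A.2).2⟩
      map_one' := rfl
      map_mul' _ _ := rfl }
  have hj : Function.Injective j := fun A B h =>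
    Subtype.ext (congrArg (fun M : Matrix.SpecialLinearGroup (Fin n) F => M.1) h)
  have hle : (Nat.card (Matrix.specialUnitaryGroup (Fin n) F)).factorization 3 ≤
      (Nat.card (Matrix.SpecialLinearGroup (Fin n) F)).factorization 3 :=
    (Nat.factorization_le_iff_dvd Nat.card_pos.ne' Nat.card_pos.ne').2
      (Subgroup.card_dvd_of_injective j hj) 3
  exact index_commutator_sylow_eq_nine_iff ha (card_three_torsion_units rfl) hn hκ
    (hle.trans (Matrix.factorization_three_card_SL (by omega) h3).le) Q

/-! ### The projective special linear and unitary groups -/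

theorem corollary5p15 (ε : Eps) (n p f : ℕ) [Fact p.Prime] (hf : 1 ≤ f) (hn : 3 ≤ n)
    (h3 : (3 : ℤ) ∣ ((p ^ f : ℕ) : ℤ) - ε.val) (Q : Sylow 3 (PSLEps ε n p f)) :
    (commutator Q).index = 9 ↔
      n = 3 ∨ (n = 4 ∧ 3 ^ padicValInt 3 (((p ^ f : ℕ) : ℤ) - ε.val) = 3) := by
  have hp : p.Prime := Fact.out
  have hpow (k : ℕ) : 3 ^ k = 3 ↔ k = 1 := by
    rw [Nat.pow_eq_self_iff (by norm_num)]
  have hq : 1 < p ^ f := Nat.one_lt_pow (by omega) hp.one_lt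
  rw [hpow]
  cases ε with
  | plus =>
    have hcast : ((p ^ f : ℕ) : ℤ) - Eps.plus.val = ((p ^ f - 1 : ℕ) : ℤ) := by
      rw [Nat.cast_sub hq.le]; rfl
    have hcard : Nat.card (GaloisField p f) = p ^ f := GaloisField.card p f (by omega)
    rw [hcast] at h3 ⊢
    rw [padicValInt.of_nat, ← Nat.factorization_def _ Nat.prime_three, ← hcard]
    exact index_commutator_sylow_SL hn (by rw [hcard]; exact_mod_cast h3) Q
  | minus =>
    have hcast : ((p ^ f : ℕ) : ℤ) - Eps.minus.val = ((p ^ f + 1 : ℕ) : ℤ) := by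
      rw [Nat.cast_add]; simp [Eps.val]
    rw [hcast] at h3 ⊢
    have h3' : 3 ∣ p ^ f + 1 := by exact_mod_cast h3
    have hcard : Nat.card (GaloisField p (2 * f)) - 1 = (p ^ f + 1) * (p ^ f - 1) := by
      rw [GaloisField.card p (2 * f) (by omega), mul_comm 2 f, pow_mul]
      simpa using Nat.sq_sub_sq (p ^ f) 1
    have hval : (Nat.card (GaloisField p (2 * f)) - 1).factorization 3 =
        (p ^ f + 1).factorization 3 := by
      rw [hcard, Nat.factorization_mul (by omega) (by omega), Finsupp.add_apply,
        Nat.factorization_eq_zero_of_not_dvd (n := p ^ f - 1) (by omega), add_zero]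
    rw [padicValInt.of_nat, ← Nat.factorization_def _ Nat.prime_three, ← hval]
    refine index_commutator_sylow_SU hn (hcard ▸ h3'.mul_right _) (fun c hc => ?_) Q
    rw [hval] at hc
    obtain ⟨m, hm⟩ := Nat.ordProj_dvd (p ^ f + 1) 3
    change (c : GaloisField p (2 * f)) * (c : GaloisField p (2 * f)) ^ p ^ f = 1
    rw [← pow_succ', ← Units.val_pow_eq_pow_val, hm, pow_mul, hc, one_pow, Units.val_one]
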